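/- Definitions. Let $\mathscr L=(\ell_1,\dots,\ell_n)$ be a finite sequence of lines through the origin of $\mathbb C^d$ (one-dimensional complex subspaces). It is linearly dependent if $\dim\operatorname{span}(\ell_1,\dots,\ell_n)<n$. Its automorphism group consists of the permutations $\sigma\in S_n$ for which there is a unitary operator $Q$ of $\mathbb C^d$ with $Q\ell_i=\ell_{\sigma(i)}$ for all $i$. The sequence $\mathscr L$ is doubly transitive if for all $x_1\ne x_2$ and $y_1\ne y_2$ in $\{1,\dots,n\}$ there is an automorphism $\sigma$ with $\sigma(x_1)=y_1$ and $\sigma(x_2)=y_2$. A roux for a finite abelian group $\Gamma$ is a matrix $B\in\mathbb C[\Gamma]^{n\times n}$ such that $B_{ii}=0$ for all $i$; $B_{ij}\in\Gamma$ and $B_{ji}=(B_{ij})^{-1}$ for all $i\ne j$; and the linear span over $\mathbb C$ of the matrices $gI$ and $gB$ ($g\in\Gamma$) is an algebra. A character $\alpha$ of $\Gamma$, extended linearly to $\mathbb C[\Gamma]$, is evaluated at $B$ entrywise to give $\hat\alpha(B)\in\mathbb C^{n\times n}$. A signature matrix is a self-adjoint complex matrix with zero diagonal and off-diagonal entries of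 modulus $1$; vectors $\varphi_1,\dots,\varphi_n$ of equal norm $\rho>0$ have signature matrix $\mathcal S$ if their Gram matrix $(\varphi_i^*\varphi_j)_{ij}$ equals $\rho^2(I+\mu\mathcal S)$ for some $\mu\ge 0$. The sequence $\mathscr L$ is a sequence of roux lines if it is linearly dependent and has equal-norm representatives $\varphi_i\in\ell_i$ with signature matrix $\hat\alpha(B)$ for some roux $B$ for some finite abelian group $\Gamma$ and some character $\alpha$ of $\Gamma$. Vectors $\varphi_1,\dots,\varphi_n$ form an equiangular tight frame for their span $W$ if there are $a>0$ and $b\ge0$ with $\sum_{i}\varphi_i\varphi_i^*x=a\,x$ for all $x\in W$ and $|\langle\varphi_i,\varphi_j\rangle|^2=b$ for all $i\ne j$. Theorem. (a) Every linearly dependent, doubly transitive sequence of lines is a sequence of roux lines. (b) Every sequence of roux lines has unit-norm representatives $\varphi_i\in\ell_i$ that form an equiangular tight frame for their span. -/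

import Mathlib

open scoped BigOperators

namespace RouxLines

/-- The complex Euclidean space of dimension `d`. -/
abbrev Cspace (d : ℕ) : Type := EuclideanSpace ℂ (Fin d)

/-- A sequence of `n` lines through the origin. Repetitions are allowed. -/
def IsLineSequence {n d : ℕ} (L : Fin n → Submodule ℂ (Cspace d)) : Prop :=
  ∀ i, Module.finrank ℂ (L i) = 1

/-- A sequence of `n` lines is linearly dependent when it spans a space of dimension less
than `n`. -/
def LinearlyDependent {n d : ℕ} (L : Fin n → Submodule ℂ (Cspace d)) : Prop :=
  Module.finrank ℂ (⨆ i, L i : Submodule ℂ (Cspace d)) < n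

/-- The automorphism group of a sequence of lines: the permutations of the lines that are induced
by unitary operators. -/
def automorphismGroup {n d : ℕ} (L : Fin n → Submodule ℂ (Cspace d)) :
    Subgroup (Equiv.Perm (Fin n)) where
  carrier := {σ | ∃ Q : Cspace d ≃ₗᵢ[ℂ] Cspace d,
    ∀ i, (L i).map (Q.toLinearEquiv : Cspace d →ₗ[ℂ] Cspace d) = L (σ i)}
  one_mem' := ⟨LinearIsometryEquiv.refl ℂ _, fun i => Submodule.map_id (L i)⟩
  mul_mem' := by
    rintro σ τ ⟨Q, hQ⟩ ⟨R, hR⟩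
    refine ⟨R.trans Q, fun i => ?_⟩
    rw [Equiv.Perm.mul_apply, ← hQ, ← hR, ← Submodule.map_comp]
    rfl
  inv_mem' := by
    rintro σ ⟨Q, hQ⟩
    refine ⟨Q.symm, fun i => ?_⟩
    have h := hQ (σ⁻¹ i)
    rw [show σ (σ⁻¹ i) = i from σ.apply_symm_apply i] at h
    rw [← h, ← Submodule.map_comp]
    have hid : (Q.symm.toLinearEquiv : Cspace d →ₗ[ℂ] Cspace d) ∘ₗ
        (Q.toLinearEquiv : Cspace d →ₗ[ℂ] Cspace d) = LinearMap.id := by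
      ext1 x
      simp
    rw [hid, Submodule.map_id]

/-- Lines are doubly transitive when their automorphism group acts doubly transitively on them. -/
def DoublyTransitive {n d : ℕ} (L : Fin n → Submodule ℂ (Cspace d)) : Prop :=
  ∀ x₁ x₂ y₁ y₂ : Fin n, x₁ ≠ x₂ → y₁ ≠ y₂ →
    ∃ σ ∈ automorphismGroup L, σ x₁ = y₁ ∧ σ x₂ = y₂

/-- The matrix `g B` over the group ring `ℂ[Γ]`, where the group element `g` is identified
with the corresponding basis vector of `ℂ[Γ]`. -/
noncomputable def groupSMul {n : ℕ} {Γ : Type} [CommGroup Γ] (g : Γ)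
    (B : Matrix (Fin n) (Fin n) (MonoidAlgebra ℂ Γ)) :
    Matrix (Fin n) (Fin n) (MonoidAlgebra ℂ Γ) :=
  MonoidAlgebra.of ℂ Γ g • B

/-- An `n × n` roux for the abelian group `Γ`. -/
structure IsRoux {n : ℕ} {Γ : Type} [CommGroup Γ]
    (B : Matrix (Fin n) (Fin n) (MonoidAlgebra ℂ Γ)) : Prop where
  diag_eq_zero : ∀ i, B i i = 0
  offDiag_mem : ∀ i j, i ≠ j → ∃ g : Γ, B i j = MonoidAlgebra.of ℂ Γ g
  offDiag_inv : ∀ i j, i ≠ j → ∀ g : Γ,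
    B i j = MonoidAlgebra.of ℂ Γ g → B j i = MonoidAlgebra.of ℂ Γ g⁻¹
  span_isAlgebra :
    ∃ A : Subalgebra ℂ (Matrix (Fin n) (Fin n) (MonoidAlgebra ℂ Γ)),
      Subalgebra.toSubmodule A =
        Submodule.span ℂ
          ((Set.range fun g : Γ => groupSMul g 1) ∪ (Set.range fun g : Γ => groupSMul g B))

/-- The entrywise evaluation of a matrix over `ℂ[Γ]` at a character `α` of `Γ`, extended linearly
to `ℂ[Γ]`. (For finite `Γ`, a multiplicative map `Γ →* ℂ` takes its values in the roots of unity,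
so these are exactly the characters of `Γ`.) -/
noncomputable def evalAtCharacter {n : ℕ} {Γ : Type} [CommGroup Γ] (α : Γ →* ℂ)
    (B : Matrix (Fin n) (Fin n) (MonoidAlgebra ℂ Γ)) : Matrix (Fin n) (Fin n) ℂ :=
  B.map (MonoidAlgebra.lift ℂ ℂ Γ α)

/-- A signature matrix: self-adjoint, zero diagonal, off-diagonal entries of modulus one. -/
structure IsSignatureMatrix {n : ℕ} (S : Matrix (Fin n) (Fin n) ℂ) : Prop where
  isHermitian : S.IsHermitian
  diag_eq_zero : ∀ i, S i i = 0
  norm_offDiag : ∀ i j, i ≠ j → ‖S i j‖ = 1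

/-- `S` is a signature matrix of the equal-norm vectors `φ`: the Gram matrix of `φ`, rescaled to
unit-norm vectors, is `I + μ S` with `μ ≥ 0`. Mathlib's inner product is conjugate-linear in the
first variable, so the `(i, j)` entry of the Gram matrix is `φᵢ* φⱼ`. -/
def IsSignatureMatrixOf {n d : ℕ} (S : Matrix (Fin n) (Fin n) ℂ) (φ : Fin n → Cspace d) : Prop :=
  IsSignatureMatrix S ∧
    ∃ r : ℝ, 0 < r ∧ (∀ i, ‖φ i‖ = r) ∧
      ∃ μ : ℝ, 0 ≤ μ ∧
        Matrix.gram ℂ φ = ((r ^ 2 : ℝ) : ℂ) • ((1 : Matrix (Fin n) (Fin n) ℂ) + (μ : ℂ) • S)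

/-- Roux lines: linearly dependent lines with equal-norm representatives whose signature matrix is
obtained by evaluating a roux for some finite abelian group at a character of that group. -/
def AreRouxLines {n d : ℕ} (L : Fin n → Submodule ℂ (Cspace d)) : Prop :=
  LinearlyDependent L ∧
    ∃ (Γ : Type) (_ : CommGroup Γ) (_ : Finite Γ)
      (B : Matrix (Fin n) (Fin n) (MonoidAlgebra ℂ Γ)) (α : Γ →* ℂ) (φ : Fin n → Cspace d),
      IsRoux B ∧ (∀ i, φ i ∈ L i) ∧ IsSignatureMatrixOf (evalAtCharacter α B) φ

/-- The vectors `φ` form an equiangular tight frame for their span: on the span, the frame operator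
`∑ φᵢ φᵢ*` is a positive multiple of the identity, and all `|⟨φᵢ, φⱼ⟩|²` with `i ≠ j` agree. -/
def IsETFForSpan {n d : ℕ} (φ : Fin n → Cspace d) : Prop :=
  (∃ a : ℝ, 0 < a ∧ ∀ x ∈ Submodule.span ℂ (Set.range φ),
      ∑ i, inner ℂ (φ i) x • φ i = (a : ℂ) • x) ∧
    ∃ b : ℝ, 0 ≤ b ∧ ∀ i j, i ≠ j → ‖inner ℂ (φ i) (φ j)‖ ^ 2 = b

end RouxLines

/-! (a) Unit representatives have inner products `c * D i j` off the diagonal with `D` unimodular;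
dependence rules out an orthonormal system, so `c > 0`. An automorphism alters `D` only by
switching, `D i j ↦ (u i)⁻¹ * u j * D i j`, so it preserves the triple products `D i j * D j k * D k
i`. The phases may be arbitrary, but a roux needs a finite group: an automorphism swapping `i` and
`j` forces `D i j ^ (2n) = (p i / p j) ^ 2` with `p i = ∏ k, D i k` (`pow_two_mul_card_of_swap`), so
rescaling by `n`-th roots of the `p i` leaves only `2n`-th roots of unity. Double transitivity then
makes the sum of triple products through an edge independent of the edge, which is the roux relation
`B² = (n - 1) I + x B` (`isRoux_hollowMatrix`).

(b) A character carries the algebra condition to a quadratic equation for the signature matrix,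
hence for the Gram matrix `G`. Dependence makes `G` singular, which kills the constant term: `G² = a
G`, the tight frame condition. -/

namespace RouxLines

/-! ### Triple products and switching -/

section Switching

variable {G ι : Type*} [CommGroup G]

lemma triple_product_switch (a b c x y z : G) :
    (a⁻¹ * b * x) * (b⁻¹ * c * y) * (c⁻¹ * a * z) = x * y * z := by
  calc _ = (a⁻¹ * a) * (b⁻¹ * b) * (c⁻¹ * c) * (x * y * z) := by ac_rfl
    _ = _ := by simp

/-- If a permutation swapping `i` and `j` preserves the triple products of a skew-symmetric array,
then `2n`-th powers of the array's entries are a coboundary. -/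
lemma pow_two_mul_card_of_swap [Fintype ι] {D : ι → ι → G}
    (hinv : ∀ i j, D j i = (D i j)⁻¹) {i j : ι} (σ : Equiv.Perm ι) (hi : σ i = j) (hj : σ j = i)
    (hσ : ∀ a b c, D (σ a) (σ b) * D (σ b) (σ c) * D (σ c) (σ a) = D a b * D b c * D c a) :
    D i j ^ (2 * Fintype.card ι) = ((∏ k, D i k) * (∏ k, D j k)⁻¹) ^ 2 := by
  have key : ∀ i j, ∏ k, (D i j * D j k * D k i)
      = D i j ^ Fintype.card ι * (∏ k, D j k) * (∏ k, D i k)⁻¹ := by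
    intro i j
    simp only [Finset.prod_mul_distrib, Finset.prod_const, Finset.card_univ, hinv i,
      Finset.prod_inv_distrib]
  -- The swap carries the triangle `i, j, k` to `j, i, σ k`, so reindexing by `σ` matches the
  -- factors.
  have h1 : ∏ k, (D i j * D j k * D k i) = ∏ k, (D j i * D i k * D k j) := by
    rw [← Equiv.prod_comp σ (fun k => D j i * D i k * D k j)]
    refine Finset.prod_congr rfl fun k _ => ?_
    rw [← hσ i j k, hi, hj]
  rw [key, key, hinv i j, inv_pow] at h1
  rw [mul_comm 2, pow_mul]
  generalize D i j ^ Fintype.card ι = x at *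
  generalize ∏ k, D i k = p at *
  generalize ∏ k, D j k = q at *
  calc x ^ 2 = x * (x * q * p⁻¹) * (p * q⁻¹) := by rw [pow_two]; group
    _ = x * (x⁻¹ * p * q⁻¹) * (p * q⁻¹) := by rw [h1]
    _ = (p * q⁻¹) ^ 2 := by rw [pow_two]; group

end Switching

/-! ### Rouxs and their evaluation at characters -/

section Roux

variable {n : ℕ} {Γ : Type} [CommGroup Γ]

/-- The hollow matrix over the group ring whose off-diagonal entries are given by `E`. -/
noncomputable def hollowMatrix (E : Fin n → Fin n → Γ) :
    Matrix (Fin n) (Fin n) (MonoidAlgebra ℂ Γ) :=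
  Matrix.of fun i j => if i = j then 0 else MonoidAlgebra.of ℂ Γ (E i j)

lemma groupSMul_eq (g : Γ) (M : Matrix (Fin n) (Fin n) (MonoidAlgebra ℂ Γ)) :
    groupSMul g M = MonoidAlgebra.of ℂ Γ g • M := rfl

/-- A submodule containing all `g M` contains `x M` for every element `x` of the group ring. -/
lemma smul_mem_of_groupSMul_mem {N : Submodule ℂ (Matrix (Fin n) (Fin n) (MonoidAlgebra ℂ Γ))}
    {M : Matrix (Fin n) (Fin n) (MonoidAlgebra ℂ Γ)} (h : ∀ g : Γ, groupSMul g M ∈ N)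
    (x : MonoidAlgebra ℂ Γ) : x • M ∈ N := by
  induction x using MonoidAlgebra.induction_on with
  | of g => exact h g
  | add x y hx hy => rw [add_smul]; exact N.add_mem hx hy
  | smul r x hx => rw [smul_assoc]; exact N.smul_mem r hx

/-- If `B ^ 2` is a combination of `1` and `B` over the group ring, the span of the `g 1` and the
`g B` is an algebra. -/
lemma span_isAlgebra_of_sq {B : Matrix (Fin n) (Fin n) (MonoidAlgebra ℂ Γ)}
    {a b : MonoidAlgebra ℂ Γ} (hB : B * B = a • 1 + b • B) :
    ∃ A : Subalgebra ℂ (Matrix (Fin n) (Fin n) (MonoidAlgebra ℂ Γ)),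
      Subalgebra.toSubmodule A =
        Submodule.span ℂ
          ((Set.range fun g : Γ => groupSMul g 1) ∪ (Set.range fun g : Γ => groupSMul g B)) := by
  set N := Submodule.span ℂ
    ((Set.range fun g : Γ => groupSMul g (1 : Matrix (Fin n) (Fin n) (MonoidAlgebra ℂ Γ))) ∪
      (Set.range fun g : Γ => groupSMul g B)) with hN
  have h1 : ∀ g : Γ, groupSMul g (1 : Matrix (Fin n) (Fin n) (MonoidAlgebra ℂ Γ)) ∈ N :=
    fun g => Submodule.subset_span (Or.inl ⟨g, rfl⟩)
  have h2 : ∀ g : Γ, groupSMul g B ∈ N := fun g => Submodule.subset_span (Or.inr ⟨g, rfl⟩)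
  have mem : ∀ x y : MonoidAlgebra ℂ Γ, x • 1 + y • B ∈ N := fun x y =>
    N.add_mem (smul_mem_of_groupSMul_mem h1 x) (smul_mem_of_groupSMul_mem h2 y)
  have form : ∀ z ∈ N, ∃ x y : MonoidAlgebra ℂ Γ, z = x • 1 + y • B := by
    intro z hz
    induction hz using Submodule.span_induction with
    | mem z hz =>
      rcases hz with ⟨g, rfl⟩ | ⟨g, rfl⟩
      · exact ⟨MonoidAlgebra.of ℂ Γ g, 0, by simp [groupSMul_eq]⟩
      · exact ⟨0, MonoidAlgebra.of ℂ Γ g, by simp [groupSMul_eq]⟩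
    | zero => exact ⟨0, 0, by simp⟩
    | add z w _ _ hz hw =>
      obtain ⟨x, y, rfl⟩ := hz
      obtain ⟨x', y', rfl⟩ := hw
      exact ⟨x + x', y + y', by simp only [add_smul]; abel⟩
    | smul r z _ hz =>
      obtain ⟨x, y, rfl⟩ := hz
      exact ⟨r • x, r • y, by rw [smul_add, smul_assoc, smul_assoc]⟩
  refine ⟨N.toSubalgebra ?_ ?_, Submodule.toSubalgebra_toSubmodule N _ _⟩
  · simpa using mem 1 0
  · intro z w hz hw
    obtain ⟨x, y, rfl⟩ := form z hz
    obtain ⟨x', y', rfl⟩ := form w hw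
    have : (x • 1 + y • B) * (x' • 1 + y' • B)
        = (x * x' + y * y' * a) • 1 + (x * y' + y * x' + y * y' * b) • B := by
      simp only [add_mul, mul_add, smul_mul_assoc, mul_smul_comm, one_mul, mul_one, hB]
      module
    rw [this]
    exact mem _ _

/-- For `i ≠ j`, the `(i, j)` entry of `B²` is `E i j` times the sum of the triple products through
that edge. Transitivity on ordered pairs makes this sum a constant of the group ring, so `B²` is a
combination of `1` and `B`. -/
lemma isRoux_hollowMatrix {E : Fin n → Fin n → Γ}
    (hinv : ∀ i j, E j i = (E i j)⁻¹)
    (htrans : ∀ i j i' j', i ≠ j → i' ≠ j' → ∃ σ : Equiv.Perm (Fin n), σ i = i' ∧ σ j = j' ∧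
      ∀ a b c, E (σ a) (σ b) * E (σ b) (σ c) * E (σ c) (σ a) = E a b * E b c * E c a)
    : IsRoux (hollowMatrix E) := by
  classical
  have offDiag : ∀ i j, i ≠ j → hollowMatrix E i j = MonoidAlgebra.of ℂ Γ (E i j) :=
    fun i j hij => by simp [hollowMatrix, hij]
  have diag : ∀ i, hollowMatrix E i i = 0 := fun i => by simp [hollowMatrix]
  refine ⟨diag, fun i j hij => ⟨_, offDiag i j hij⟩, ?_, ?_⟩
  · intro i j hij g hg
    rw [offDiag i j hij] at hg
    rw [offDiag j i hij.symm, hinv i j, MonoidAlgebra.of_injective hg]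
  -- the triangle sums through an edge, as elements of the group ring
  let X : Fin n → Fin n → MonoidAlgebra ℂ Γ := fun i j =>
    ∑ k, if i = k ∨ k = j then 0 else MonoidAlgebra.of ℂ Γ (E i k * E k j * E j i)
  have hX : ∀ i j i' j', i ≠ j → i' ≠ j' → X i' j' = X i j := by
    intro i j i' j' hij hij'
    obtain ⟨σ, hi, hj, hσ⟩ := htrans i j i' j' hij hij'
    simp only [X]
    rw [← Equiv.sum_comp σ]
    refine Finset.sum_congr rfl fun k _ => ?_
    rw [← hi, ← hj, hσ]
    simp only [σ.injective.eq_iff]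
  obtain ⟨x, hx⟩ : ∃ x, ∀ i j, i ≠ j → X i j = x := by
    by_cases h : ∃ i j : Fin n, i ≠ j
    · obtain ⟨i, j, hij⟩ := h
      exact ⟨X i j, fun i' j' hij' => hX i j i' j' hij hij'⟩
    · push Not at h
      exact ⟨0, fun i j hij => absurd (h i j) hij⟩
  -- Each diagonal entry of `B²` counts the `k ≠ i`. Truncation at `n = 0` is harmless: there are no
  -- entries.
  refine span_isAlgebra_of_sq (a := ((n - 1 : ℕ) : MonoidAlgebra ℂ Γ)) (b := x) ?_
  ext1 i j
  rw [Matrix.mul_apply, Matrix.add_apply, Matrix.smul_apply, Matrix.smul_apply, smul_eq_mul,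
    smul_eq_mul]
  by_cases hij : i = j
  · subst hij
    rw [diag, mul_zero, add_zero, Matrix.one_apply_eq, mul_one]
    have : ∀ k, hollowMatrix E i k * hollowMatrix E k i = if k = i then 0 else 1 := by
      intro k
      split_ifs with hk
      · rw [hk, diag, zero_mul]
      · rw [offDiag i k (Ne.symm hk), offDiag k i hk, ← map_mul, hinv i k, mul_inv_cancel, map_one]
    rw [Finset.sum_congr rfl fun k _ => this k]
    simp [Finset.sum_ite, Finset.filter_ne']
  · rw [Matrix.one_apply_ne hij, mul_zero, zero_add, ← hx i j hij, offDiag i j hij, Finset.sum_mul]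
    refine Finset.sum_congr rfl fun k _ => ?_
    by_cases hk : i = k ∨ k = j
    · rw [if_pos hk, zero_mul]
      rcases hk with rfl | rfl
      · rw [diag, zero_mul]
      · rw [diag, mul_zero]
    · rw [if_neg hk]
      push Not at hk
      rw [offDiag i k hk.1, offDiag k j hk.2, ← map_mul, ← map_mul, hinv i j, inv_mul_cancel_right]

lemma evalAtCharacter_hollowMatrix (α : Γ →* ℂ) (E : Fin n → Fin n → Γ) (i j : Fin n) :
    evalAtCharacter α (hollowMatrix E) i j = if i = j then 0 else α (E i j) := by
  simp only [evalAtCharacter, hollowMatrix, Matrix.map_apply, Matrix.of_apply]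
  split_ifs <;> simp

/-- The evaluation of a roux at a character satisfies a quadratic equation. -/
lemma IsRoux.exists_evalAtCharacter_sq {B : Matrix (Fin n) (Fin n) (MonoidAlgebra ℂ Γ)}
    (hB : IsRoux B) (α : Γ →* ℂ) :
    ∃ a b : ℂ, evalAtCharacter α B * evalAtCharacter α B = a • 1 + b • evalAtCharacter α B := by
  obtain ⟨A, hA⟩ := hB.span_isAlgebra
  have hBA : B ∈ A := by
    rw [← Subalgebra.mem_toSubmodule, hA]
    exact Submodule.subset_span (Or.inr ⟨1, by simp only [groupSMul_eq, map_one, one_smul]⟩)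
  have hBB : B * B ∈ Subalgebra.toSubmodule A := A.mul_mem hBA hBA
  rw [hA] at hBB
  have smul_map : ∀ (g : Γ) (M : Matrix (Fin n) (Fin n) (MonoidAlgebra ℂ Γ)),
      evalAtCharacter α (groupSMul g M) = α g • evalAtCharacter α M := by
    intro g M
    ext i j
    simp [evalAtCharacter, groupSMul_eq]
  have one_map : evalAtCharacter α (1 : Matrix (Fin n) (Fin n) (MonoidAlgebra ℂ Γ)) = 1 := by
    simp [evalAtCharacter]
  have form : ∀ z ∈ Submodule.span ℂ
      ((Set.range fun g : Γ => groupSMul g (1 : Matrix (Fin n) (Fin n) (MonoidAlgebra ℂ Γ))) ∪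
        (Set.range fun g : Γ => groupSMul g B)),
      ∃ a b : ℂ, evalAtCharacter α z = a • 1 + b • evalAtCharacter α B := by
    intro z hz
    induction hz using Submodule.span_induction with
    | mem z hz =>
      rcases hz with ⟨g, rfl⟩ | ⟨g, rfl⟩
      · exact ⟨α g, 0, by simp only [smul_map, one_map, zero_smul, add_zero]⟩
      · exact ⟨0, α g, by simp only [smul_map, zero_smul, zero_add]⟩
    | zero => exact ⟨0, 0, by ext; simp [evalAtCharacter]⟩
    | add z w _ _ hz hw =>
      obtain ⟨x, y, hz⟩ := hz
      obtain ⟨x', y', hw⟩ := hw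
      refine ⟨x + x', y + y', ?_⟩
      have : evalAtCharacter α (z + w) = evalAtCharacter α z + evalAtCharacter α w := by
        ext; simp [evalAtCharacter]
      rw [this, hz, hw]
      module
    | smul r z _ hz =>
      obtain ⟨x, y, hz⟩ := hz
      refine ⟨r * x, r * y, ?_⟩
      have : evalAtCharacter α (r • z) = r • evalAtCharacter α z := by
        ext; simp [evalAtCharacter]
      rw [this, hz]
      module
  obtain ⟨a, b, h⟩ := form _ hBB
  refine ⟨a, b, ?_⟩
  rw [← h]
  exact (Matrix.map_mul (f := (MonoidAlgebra.lift ℂ ℂ Γ α : MonoidAlgebra ℂ Γ →+* ℂ))).symm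

end Roux

/-! ### From roux lines to tight frames -/

variable {n d : ℕ}

lemma span_range_eq_iSup {L : Fin n → Submodule ℂ (Cspace d)} (hL : IsLineSequence L)
    {φ : Fin n → Cspace d} (hφ : ∀ i, φ i ∈ L i) (h0 : ∀ i, φ i ≠ 0) :
    Submodule.span ℂ (Set.range φ) = ⨆ i, L i := by
  rw [Submodule.span_range_eq_iSup]
  refine iSup_congr fun i => ?_
  refine Submodule.eq_of_le_of_finrank_eq ?_ ?_
  · rw [Submodule.span_singleton_le_iff_mem]
    exact hφ i
  · rw [finrank_span_singleton (h0 i), hL i]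

lemma LinearlyDependent.not_linearIndependent {L : Fin n → Submodule ℂ (Cspace d)}
    (hdep : LinearlyDependent L) (hL : IsLineSequence L)
    {φ : Fin n → Cspace d} (hφ : ∀ i, φ i ∈ L i) (h0 : ∀ i, φ i ≠ 0) :
    ¬ LinearIndependent ℂ φ := by
  intro h
  have := finrank_span_eq_card h
  rw [span_range_eq_iSup hL hφ h0, Fintype.card_fin] at this
  exact absurd hdep (by rw [LinearlyDependent, this]; exact lt_irrefl n)

/-- If the square of the Gram matrix is a multiple of the Gram matrix, the frame operator is the
same multiple of the identity on the span. -/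
lemma frame_operator_eq_smul_of_gram_sq {φ : Fin n → Cspace d} {a : ℂ}
    (h : Matrix.gram ℂ φ * Matrix.gram ℂ φ = a • Matrix.gram ℂ φ)
    {x : Cspace d} (hx : x ∈ Submodule.span ℂ (Set.range φ)) :
    ∑ i, inner ℂ (φ i) x • φ i = a • x := by
  induction hx using Submodule.span_induction with
  | mem x hx =>
    obtain ⟨j, rfl⟩ := hx
    -- The defect `v` is a combination of the `φ k` and orthogonal to each of them, hence to itself.
    set v := ∑ i, inner ℂ (φ i) (φ j) • φ i - a • φ j with hv
    have hk : ∀ k, inner ℂ (φ k) v = 0 := by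
      intro k
      have := congrFun (congrFun h k) j
      rw [Matrix.mul_apply, Matrix.smul_apply, smul_eq_mul] at this
      simp only [Matrix.gram_apply] at this
      rw [hv, inner_sub_right, inner_sum, inner_smul_right, ← this, sub_eq_zero]
      exact Finset.sum_congr rfl fun i _ => by rw [inner_smul_right, mul_comm]
    have hvv : inner ℂ v v = (0 : ℂ) := by
      nth_rewrite 1 [hv]
      rw [inner_sub_left, sum_inner, inner_smul_left, hk, mul_zero, sub_zero]
      exact Finset.sum_eq_zero fun i _ => by rw [inner_smul_left, hk, mul_zero]
    exact sub_eq_zero.mp (inner_self_eq_zero.mp hvv)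
  | zero => simp
  | add x y _ _ hx hy =>
    simp only [inner_add_right, add_smul, Finset.sum_add_distrib, hx, hy, smul_add]
  | smul r x _ hx =>
    rw [smul_comm, ← hx, Finset.smul_sum]
    exact Finset.sum_congr rfl fun i _ => by rw [inner_smul_right, mul_smul]

/-- Vectors with a singular Gram matrix satisfying a quadratic equation form a tight frame. -/
lemma exists_gram_sq_eq_smul {φ : Fin n → Cspace d} (hφ : ∀ i, ‖φ i‖ = 1)
    (hdep : ¬ LinearIndependent ℂ φ) {u v : ℂ}
    (h : Matrix.gram ℂ φ * Matrix.gram ℂ φ = u • 1 + v • Matrix.gram ℂ φ) :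
    ∃ a : ℝ, 0 < a ∧ Matrix.gram ℂ φ * Matrix.gram ℂ φ = (a : ℂ) • Matrix.gram ℂ φ := by
  obtain ⟨x, hx, i, hi⟩ := Fintype.not_linearIndependent_iff.mp hdep
  have hGx : (Matrix.gram ℂ φ).mulVec x = 0 := by
    ext k
    have : inner ℂ (φ k) (∑ i, x i • φ i) = (0 : ℂ) := by rw [hx, inner_zero_right]
    rw [inner_sum] at this
    rw [Matrix.mulVec, dotProduct, Pi.zero_apply, ← this]
    exact Finset.sum_congr rfl fun i _ => by rw [inner_smul_right, Matrix.gram_apply, mul_comm]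
  -- Applying the quadratic relation to the kernel vector `x` leaves `u • x = 0`.
  have hu : u = 0 := by
    have h2 := congrArg (fun M => Matrix.mulVec M x) h
    simp only [← Matrix.mulVec_mulVec, hGx, Matrix.mulVec_zero, Matrix.add_mulVec,
      Matrix.smul_mulVec, Matrix.one_mulVec, smul_zero, add_zero] at h2
    have h3 := congrFun h2 i
    rw [Pi.smul_apply, Pi.zero_apply, smul_eq_mul] at h3
    exact (mul_eq_zero.mp h3.symm).resolve_right hi
  rw [hu, zero_smul, zero_add] at h
  -- The `(i, i)` entry of `G² = v G` shows that `v` is real; it is positive because the term `k =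
  -- i` is `1`.
  have hv : ((∑ k, ‖(inner ℂ (φ i) (φ k) : ℂ)‖ ^ 2 : ℝ) : ℂ) = v := by
    have h4 := congrFun (congrFun h i) i
    rw [Matrix.mul_apply, Matrix.smul_apply, smul_eq_mul] at h4
    simp only [Matrix.gram_apply] at h4
    rw [inner_self_eq_norm_sq_to_K, hφ] at h4
    push_cast
    simp only [RCLike.ofReal_one, one_pow, mul_one] at h4
    rw [← h4]
    refine Finset.sum_congr rfl fun k _ => ?_
    rw [← inner_conj_symm (φ k) (φ i), Complex.mul_conj, Complex.normSq_eq_norm_sq]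
    push_cast
    rfl
  refine ⟨_, ?_, by rw [hv]; exact h⟩
  refine Finset.sum_pos' (fun k _ => by positivity) ⟨i, Finset.mem_univ i, ?_⟩
  rw [inner_self_eq_norm_sq_to_K, hφ]
  simp

/-- Roux lines are spanned by unit vectors that form an equiangular tight frame for their span. -/
lemma AreRouxLines.exists_etf {L : Fin n → Submodule ℂ (Cspace d)} (hL : IsLineSequence L)
    (h : AreRouxLines L) :
    ∃ φ : Fin n → Cspace d, (∀ i, φ i ∈ L i) ∧ (∀ i, ‖φ i‖ = 1) ∧ IsETFForSpan φ := by
  obtain ⟨hdep, Γ, _, _, B, α, ψ, hB, hψL, hS, r, hr, hnorm, μ, hμ, hG⟩ := h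
  obtain ⟨a, b, hsq⟩ := hB.exists_evalAtCharacter_sq α
  set S := evalAtCharacter α B
  have hrC : (r : ℂ) ≠ 0 := by exact_mod_cast hr.ne'
  let φ : Fin n → Cspace d := fun i => (r : ℂ)⁻¹ • ψ i
  have hφL : ∀ i, φ i ∈ L i := fun i => (L i).smul_mem _ (hψL i)
  have hφ1 : ∀ i, ‖φ i‖ = 1 := by
    intro i
    rw [norm_smul, hnorm, norm_inv, Complex.norm_real, Real.norm_of_nonneg hr.le,
      inv_mul_cancel₀ hr.ne']
  have hφ0 : ∀ i, φ i ≠ 0 := fun i => norm_ne_zero_iff.mp (by rw [hφ1]; exact one_ne_zero)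
  have hφG : Matrix.gram ℂ φ = 1 + (μ : ℂ) • S := by
    ext i j
    have := congrFun (congrFun hG i) j
    rw [Matrix.gram_apply, Matrix.smul_apply, smul_eq_mul] at this
    rw [Matrix.gram_apply, inner_smul_left, inner_smul_right, this, map_inv₀, Complex.conj_ofReal]
    push_cast
    field_simp
  -- Coefficients chosen so that no division by `μ`, which may vanish, is needed.
  have hquad : Matrix.gram ℂ φ * Matrix.gram ℂ φ
      = (μ ^ 2 * a - 1 - μ * b : ℂ) • 1 + (2 + μ * b : ℂ) • Matrix.gram ℂ φ := by
    rw [hφG]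
    simp only [add_mul, mul_add, smul_mul_assoc, mul_smul_comm, one_mul, mul_one, hsq]
    module
  obtain ⟨c, hc, hGc⟩ := exists_gram_sq_eq_smul hφ1
    (hdep.not_linearIndependent hL hφL hφ0) hquad
  refine ⟨φ, hφL, hφ1, ⟨c, hc, fun x hx => frame_operator_eq_smul_of_gram_sq hGc hx⟩,
    μ ^ 2, by positivity, fun i j hij => ?_⟩
  have := congrFun (congrFun hφG i) j
  rw [Matrix.gram_apply, Matrix.add_apply, Matrix.one_apply_ne hij, zero_add, Matrix.smul_apply,
    smul_eq_mul] at this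
  rw [this, norm_mul, hS.norm_offDiag i j hij, mul_one, Complex.norm_real,
    Real.norm_of_nonneg hμ]


/-! ### From double transitivity to roux lines -/

variable {n d : ℕ}

lemma IsLineSequence.exists_unit_representatives {L : Fin n → Submodule ℂ (Cspace d)}
    (hL : IsLineSequence L) :
    ∃ φ : Fin n → Cspace d, (∀ i, φ i ∈ L i) ∧ (∀ i, ‖φ i‖ = 1) := by
  have : ∀ i, ∃ x : Cspace d, x ∈ L i ∧ ‖x‖ = 1 := by
    intro i
    have : Nontrivial (L i) := Module.nontrivial_of_finrank_pos (R := ℂ) (by rw [hL i]; exact one_pos)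
    obtain ⟨x, hx⟩ := exists_norm_eq (L i) zero_le_one
    exact ⟨x, x.2, hx⟩
  choose φ hφ using this
  exact ⟨φ, fun i => (hφ i).1, fun i => (hφ i).2⟩

/-- A unitary operator permuting lines permutes unit representatives up to phases. -/
lemma exists_phases_of_mem_automorphismGroup {L : Fin n → Submodule ℂ (Cspace d)}
    (hL : IsLineSequence L) {φ : Fin n → Cspace d} (hφL : ∀ i, φ i ∈ L i) (hφ1 : ∀ i, ‖φ i‖ = 1)
    {σ : Equiv.Perm (Fin n)} (hσ : σ ∈ automorphismGroup L) :
    ∃ u : Fin n → Circle, ∀ i j,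
      inner ℂ (φ i) (φ j) = ((u i)⁻¹ * u j : Circle) * inner ℂ (φ (σ i)) (φ (σ j)) := by
  obtain ⟨Q, hQ⟩ := hσ
  have h0 : ∀ i, φ i ≠ 0 := fun i => norm_ne_zero_iff.mp (by rw [hφ1]; exact one_ne_zero)
  have : ∀ i, ∃ u : Circle, Q (φ i) = (u : ℂ) • φ (σ i) := by
    intro i
    have hmem : Q (φ i) ∈ L (σ i) := by
      rw [← hQ i]
      exact Submodule.mem_map_of_mem (hφL i)
    have hspan : Submodule.span ℂ {φ (σ i)} = L (σ i) := by
      refine Submodule.eq_of_le_of_finrank_eq ?_ ?_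
      · rw [Submodule.span_singleton_le_iff_mem]
        exact hφL _
      · rw [finrank_span_singleton (h0 _), hL]
    rw [← hspan, Submodule.mem_span_singleton] at hmem
    obtain ⟨c, hc⟩ := hmem
    have hc1 : ‖c‖ = 1 := by
      have := congrArg norm hc
      rwa [norm_smul, Q.norm_map, hφ1, hφ1, mul_one] at this
    exact ⟨⟨c, mem_sphere_zero_iff_norm.mpr hc1⟩, hc.symm⟩
  choose u hu using this
  refine ⟨u, fun i j => ?_⟩
  rw [← Q.inner_map_map, hu, hu, inner_smul_left, inner_smul_right, Circle.coe_mul,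
    Circle.coe_inv_eq_conj, mul_assoc]

lemma exists_circle_pow_eq {m : ℕ} (hm : m ≠ 0) (z : Circle) : ∃ w : Circle, w ^ m = z := by
  refine ⟨Circle.exp (Complex.arg z / m), ?_⟩
  rw [← Circle.exp_nsmul]
  have : (m : ℝ) ≠ 0 := by exact_mod_cast hm
  rw [nsmul_eq_mul, mul_div_cancel₀ _ this, Circle.exp_arg]

/-- Linearly dependent doubly transitive lines have unit representatives whose inner products are
a common positive multiple of phases. -/
lemma exists_representatives_with_phases {L : Fin n → Submodule ℂ (Cspace d)}
    (hL : IsLineSequence L) (hdep : LinearlyDependent L) (hdt : DoublyTransitive L) :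
    ∃ φ : Fin n → Cspace d, (∀ i, φ i ∈ L i) ∧ (∀ i, ‖φ i‖ = 1) ∧ ∃ c : ℝ, 0 < c ∧
      ∃ D : Fin n → Fin n → Circle, (∀ i, D i i = 1) ∧ (∀ i j, D j i = (D i j)⁻¹) ∧
        ∀ i j, i ≠ j → inner ℂ (φ i) (φ j) = c * (D i j : ℂ) := by
  obtain ⟨φ, hφL, hφ1⟩ := hL.exists_unit_representatives
  have h0 : ∀ i, φ i ≠ 0 := fun i => norm_ne_zero_iff.mp (by rw [hφ1]; exact one_ne_zero)
  obtain ⟨i₀, j₀, hij₀, hne⟩ : ∃ i j, i ≠ j ∧ inner ℂ (φ i) (φ j) ≠ (0 : ℂ) := by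
    by_contra! h
    exact hdep.not_linearIndependent hL hφL h0
      (Orthonormal.linearIndependent ⟨hφ1, fun i j hij => h i j hij⟩)
  have hc : ∀ i j, i ≠ j → ‖(inner ℂ (φ i) (φ j) : ℂ)‖ = ‖(inner ℂ (φ i₀) (φ j₀) : ℂ)‖ := by
    intro i j hij
    obtain ⟨σ, hσ, rfl, rfl⟩ := hdt i₀ j₀ i j hij₀ hij
    obtain ⟨u, hu⟩ := exists_phases_of_mem_automorphismGroup hL hφL hφ1 hσ
    rw [hu i₀ j₀, norm_mul, Circle.norm_coe, one_mul]
  set c := ‖(inner ℂ (φ i₀) (φ j₀) : ℂ)‖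
  have hcpos : 0 < c := norm_pos_iff.mpr hne
  have hcC : (c : ℂ) ≠ 0 := by exact_mod_cast hcpos.ne'
  have : ∀ i j, ∃ z : Circle,
      (i = j → z = 1) ∧ (i ≠ j → inner ℂ (φ i) (φ j) = c * (z : ℂ)) := by
    intro i j
    by_cases hij : i = j
    · exact ⟨1, fun _ => rfl, fun h => absurd hij h⟩
    · refine ⟨⟨inner ℂ (φ i) (φ j) / c, ?_⟩, fun h => absurd h hij, fun _ => ?_⟩
      · refine mem_sphere_zero_iff_norm.mpr ?_
        rw [norm_div, hc i j hij, Complex.norm_real,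
          Real.norm_of_nonneg hcpos.le, div_self hcpos.ne']
      · exact (mul_div_cancel₀ _ hcC).symm
  choose D hD1 hD using this
  refine ⟨φ, hφL, hφ1, c, hcpos, D, fun i => hD1 i i rfl, fun i j => ?_, hD⟩
  by_cases hij : i = j
  · subst hij
    rw [hD1 i i rfl, inv_one]
  · apply Circle.ext
    apply mul_left_cancel₀ hcC
    rw [← hD j i (Ne.symm hij), ← inner_conj_symm, hD i j hij, map_mul, Complex.conj_ofReal,
      Circle.coe_inv_eq_conj]

lemma areRouxLines_of_doublyTransitive {L : Fin n → Submodule ℂ (Cspace d)}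
    (hL : IsLineSequence L) (hdep : LinearlyDependent L) (hdt : DoublyTransitive L) :
    AreRouxLines L := by
  have hn : n ≠ 0 := (Nat.zero_lt_of_lt hdep).ne'
  obtain ⟨φ, hφL, hφ1, c, hc, D, hD1, hDinv, hD⟩ :=
    exists_representatives_with_phases hL hdep hdt
  have hcC : (c : ℂ) ≠ 0 := by exact_mod_cast hc.ne'
  have htriple : ∀ σ ∈ automorphismGroup L, ∀ x y z,
      D (σ x) (σ y) * D (σ y) (σ z) * D (σ z) (σ x) = D x y * D y z * D z x := by
    intro σ hσ x y z
    obtain ⟨u, hu⟩ := exists_phases_of_mem_automorphismGroup hL hφL hφ1 hσ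
    have hDu : ∀ i j, D i j = (u i)⁻¹ * u j * D (σ i) (σ j) := by
      intro i j
      by_cases hij : i = j
      · subst hij
        rw [hD1, hD1, inv_mul_cancel, mul_one]
      · apply Circle.ext
        apply mul_left_cancel₀ hcC
        rw [← hD i j hij, hu, hD _ _ (σ.injective.ne hij), Circle.coe_mul _ (D _ _)]
        ring
    rw [hDu x y, hDu y z, hDu z x, triple_product_switch]
  -- `n`-th roots of the row products: their `2n`-th powers cancel the coboundary `(p i / p j) ^ 2`.
  choose w hw using fun i => exists_circle_pow_eq hn (∏ k, D i k)
  -- switching by `w` turns all entries into roots of unity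
  have hroot : ∀ i j, ((w i)⁻¹ * w j * D i j) ^ (2 * n) = 1 := by
    intro i j
    by_cases hij : i = j
    · subst hij
      rw [hD1, inv_mul_cancel, one_mul, one_pow]
    · obtain ⟨σ, hσ, hi, hj⟩ := hdt i j j i hij (Ne.symm hij)
      have := pow_two_mul_card_of_swap hDinv σ hi hj (htriple σ hσ)
      rw [Fintype.card_fin] at this
      rw [mul_pow, this, mul_comm 2 n, pow_mul, mul_pow, inv_pow, hw, hw, ← mul_pow]
      rw [show (∏ k, D i k)⁻¹ * ∏ k, D j k = ((∏ k, D i k) * (∏ k, D j k)⁻¹)⁻¹ by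
        rw [mul_inv, inv_inv], inv_mul_cancel, one_pow]
  -- Needed for the group of `2n`-th roots of unity to be finite.
  have : NeZero (2 * n) := ⟨by omega⟩
  let E : Fin n → Fin n → rootsOfUnity (2 * n) ℂ := fun i j =>
    ⟨Circle.toUnits ((w i)⁻¹ * w j * D i j), by
      rw [mem_rootsOfUnity, ← map_pow, hroot, map_one]⟩
  let α : rootsOfUnity (2 * n) ℂ →* ℂ := (Units.coeHom ℂ).comp (Subgroup.subtype _)
  have hα : ∀ i j, α (E i j) = ((w i)⁻¹ * w j * D i j : Circle) := fun i j => rfl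
  have hEinv : ∀ i j, E j i = (E i j)⁻¹ := by
    intro i j
    apply Subtype.ext
    change Circle.toUnits _ = (Circle.toUnits _)⁻¹
    rw [← map_inv, hDinv i j, mul_inv, mul_inv, inv_inv, mul_comm (w i)]
  have hEtrans : ∀ i j i' j', i ≠ j → i' ≠ j' → ∃ σ : Equiv.Perm (Fin n), σ i = i' ∧ σ j = j' ∧
      ∀ a b c, E (σ a) (σ b) * E (σ b) (σ c) * E (σ c) (σ a) = E a b * E b c * E c a := by
    intro i j i' j' hij hij'
    obtain ⟨σ, hσ, hi, hj⟩ := hdt i j i' j' hij hij'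
    refine ⟨σ, hi, hj, fun x y z => Subtype.ext ?_⟩
    change Circle.toUnits _ * Circle.toUnits _ * Circle.toUnits _
      = Circle.toUnits _ * Circle.toUnits _ * Circle.toUnits _
    simp only [← map_mul]
    rw [triple_product_switch, triple_product_switch, htriple σ hσ]
  have hval : ∀ i j, evalAtCharacter α (hollowMatrix E) i j
      = if i = j then 0 else (((w i)⁻¹ * w j * D i j : Circle) : ℂ) :=
    fun i j => evalAtCharacter_hollowMatrix α E i j
  have hψ1 : ∀ i, ‖(w i : ℂ) • φ i‖ = 1 := fun i => by
    rw [norm_smul, Circle.norm_coe, hφ1, one_mul]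
  refine ⟨hdep, rootsOfUnity (2 * n) ℂ, inferInstance, inferInstance, hollowMatrix E, α,
    fun i => (w i : ℂ) • φ i, isRoux_hollowMatrix hEinv hEtrans,
    fun i => (L i).smul_mem _ (hφL i), ⟨?_, ?_, ?_⟩, 1, one_pos, hψ1, c, hc.le, ?_⟩
  · ext i j
    rw [Matrix.conjTranspose_apply, hval, hval]
    by_cases hij : i = j
    · simp [hij]
    · rw [if_neg hij, if_neg (Ne.symm hij), hDinv i j]
      change starRingEnd ℂ _ = _
      rw [← Circle.coe_inv_eq_conj, mul_inv, mul_inv, inv_inv, inv_inv, mul_comm (w j)]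
  · intro i
    rw [hval, if_pos rfl]
  · intro i j hij
    rw [hval, if_neg hij, Circle.norm_coe]
  · ext i j
    rw [Matrix.gram_apply, Matrix.smul_apply, Matrix.add_apply, Matrix.smul_apply, hval]
    by_cases hij : i = j
    · subst hij
      rw [inner_self_eq_norm_sq_to_K, hψ1]
      simp
    · rw [if_neg hij, Matrix.one_apply_ne hij, inner_smul_left, inner_smul_right, hD i j hij,
        Circle.coe_mul, Circle.coe_mul, Circle.coe_inv_eq_conj]
      simp
      ring

end RouxLines

theorem theorem2p3 {n d : ℕ} (L : Fin n → Submodule ℂ (RouxLines.Cspace d))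
    (hL : RouxLines.IsLineSequence L) :
    (RouxLines.LinearlyDependent L → RouxLines.DoublyTransitive L → RouxLines.AreRouxLines L) ∧
    (RouxLines.AreRouxLines L →
      ∃ φ : Fin n → RouxLines.Cspace d,
        (∀ i, φ i ∈ L i) ∧ (∀ i, ‖φ i‖ = 1) ∧ RouxLines.IsETFForSpan φ) :=
  ⟨RouxLines.areRouxLines_of_doublyTransitive hL, RouxLines.AreRouxLines.exists_etf hL⟩
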